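/- Let $X$ be a scheme of finite type over $\mathbf{Z}$, let $X_{(0)}$ be its set of closed points, and for $x\in X_{(0)}$ let $N(x)$ be the cardinality of the residue field $\kappa(x)$. Let $Z_0(X)^+$ be the set of effective $0$-cycles $c=\sum_{x\in X_{(0)}} n_x\,x$ (finite formal sums with $n_x\in\mathbf{Z}_{\ge 0}$), and put $N(c)=\prod_x N(x)^{n_x}$. Then every $N(x)$ is finite, and for each integer $n$ the number $a_n$ of effective $0$-cycles $c$ with $N(c)=n$ is finite. Let $\dim X$ be the Krull dimension of $X$ (with $\dim\emptyset=-\infty$). For every $s\in\mathbf{C}$ with $\operatorname{Re}(s)>\dim X$, the zeta function $$\zeta(X,s)=\prod_{x\in X_{(0)}}\frac{1}{1-N(x)^{-s}}=\sum_{c\in Z_0(X)^+}\frac{1}{N(c)^s}=\sum_{n\ge 1}\frac{a_n}{n^s}$$ converges absolutely, as an infinite product and as a series. That is: - $1-N(x)^{-s}\neq 0$ for every $x\in X_{(0)}$, $\sum_{x}\left|(1-N(x)^{-s})^{-1}-1\right|<\infty$, and the product over $x\in X_{(0)}$ converges unconditionally; - $\sum_{c}\left|N(c)^{-s}\right|<\infty$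 and $\sum_{n\ge1}\left|a_n n^{-s}\right|<\infty$; - the product and both series have the same value $\zeta(X,s)$. -/

import Mathlib

open AlgebraicGeometry CategoryTheory

universe u

noncomputable section

/-- A scheme is of finite type over `ℤ` if its unique morphism to `Spec ℤ` is locally of finite
type and quasi-compact. (`ULift` only moves `ℤ` to the universe of the scheme.) -/
structure AlgebraicGeometry.Scheme.IsFiniteTypeInt (X : Scheme.{u}) : Prop where
  locallyOfFiniteType : LocallyOfFiniteType (specULiftZIsTerminal.{u}.from X)
  quasiCompact : QuasiCompact (specULiftZIsTerminal.{u}.from X)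

/-- The Krull dimension of a scheme as an extended real number; it is `⊥` (that is, `-∞`) for the
empty scheme and the usual dimension otherwise. -/
def AlgebraicGeometry.Scheme.dimEReal (X : Scheme.{u}) : EReal :=
  WithBot.recBotCoe ⊥ (fun n : ℕ∞ => ((n : ENNReal) : EReal)) (topologicalKrullDim X)

namespace SchemeZeta

variable (X : Scheme.{u})

/-- The set `X₍₀₎` of closed points, as a type. -/
abbrev ClosedPoint : Type u := closedPoints X

variable {X} in
/-- `N(x)`, the number of elements of the residue field `κ(x)`. -/
def pointNorm (x : ClosedPoint X) : ℕ := Nat.card (X.residueField x.1)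

/-- The Euler factor `(1 - N(x)⁻ˢ)⁻¹`. -/
def eulerFactor (s : ℂ) (x : ClosedPoint X) : ℂ := (1 - (pointNorm x : ℂ) ^ (-s))⁻¹

/-- The zeta function `ζ(X, s) = ∏ₓ (1 - N(x)⁻ˢ)⁻¹`, the product over all closed points. -/
def zeta (s : ℂ) : ℂ := ∏' x : ClosedPoint X, eulerFactor X s x

/-- Effective `0`-cycles: formal sums `∑ nₓ x` of closed points with coefficients in `ℕ`. -/
abbrev EffectiveZeroCycle : Type u := ClosedPoint X →₀ ℕ

variable {X} in
/-- `N(c) = ∏ N(x) ^ nₓ` for `c = ∑ nₓ x`. -/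
def cycleNorm (c : EffectiveZeroCycle X) : ℕ := c.prod fun x n => pointNorm x ^ n

/-- The `n`-th coefficient of the Dirichlet series of `ζ(X, s)`: the number of effective
`0`-cycles of norm `n`. -/
def dirichletCoeff (n : ℕ) : ℂ := (Nat.card {c : EffectiveZeroCycle X // cycleNorm c = n} : ℂ)

end SchemeZeta

end

open scoped ENNReal

attribute [local instance] MvPolynomial.algebraMvPolynomial

/-! Everything rests on ∑ₓ N(x)^(-σ) < ∞ for real σ > dim X. Given this, the Euler product expands
as for the Riemann zeta function (`hasSum_finsuppProd`), and collecting cycles of equal norm gives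
the Dirichlet series.

A finite affine cover and the finiteness of minimal primes reduce convergence to domains A of finite
type over ℤ with dim A ≤ d. A maximal ideal whose residue field has q elements is the kernel of a
homomorphism A → 𝔽_q. If A is finite over S[X₁,…,Xₙ], where S has at most one map to any field,
there are at most C qⁿ such homomorphisms, with C independent of q.

In characteristic p, Noether normalization over 𝔽_p gives n ≤ d. Only powers of p occur as q, so a
geometric series with ratio p^(n-σ) dominates.

In characteristic 0, normalization holds over ℤ[1/f], and dim ℤ[1/f] ≥ 1 forces n + 1 ≤ d. The
maximal ideals avoiding f are controlled by ∑ q^(n-σ). The others contain some prime p ∣ f and come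
from A/p, which falls under characteristic p. -/

/-! ### Krull dimension under localization and integral extension. -/

theorem ringKrullDim_le_of_isLocalization {R : Type*} (S : Type*) [CommRing R] [CommRing S]
    [Algebra R S] (M : Submonoid R) [IsLocalization M S] : ringKrullDim S ≤ ringKrullDim R := by
  rw [← PrimeSpectrum.topologicalKrullDim_eq_ringKrullDim,
    ← PrimeSpectrum.topologicalKrullDim_eq_ringKrullDim]
  exact (PrimeSpectrum.localization_comap_isInducing S M).topologicalKrullDim_le

/-- Lying over for the bottom of a chain of primes (available because the kernel is zero), then
going up for the rest. -/
theorem ringKrullDim_le_of_isIntegral_of_injective (R S : Type*) [CommRing R] [CommRing S]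
    [Algebra R S] [Algebra.IsIntegral R S] (h : Function.Injective (algebraMap R S)) :
    ringKrullDim R ≤ ringKrullDim S := by
  refine iSup_le fun l => ?_
  obtain ⟨P, -, hP, hPl⟩ := Ideal.exists_ideal_over_prime_of_isIntegral l.head.asIdeal (⊥ : Ideal S)
    (by rw [← RingHom.ker_eq_comap_bot, (RingHom.injective_iff_ker_eq_bot _).mp h]; exact bot_le)
  have : P.LiesOver l.head.asIdeal := ⟨hPl.symm⟩
  obtain ⟨L, hL, -⟩ := Ideal.exists_ltSeries_of_hasGoingUp l P
  rw [← hL]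
  exact Order.LTSeries.length_le_krullDim L

/-! ### Finiteness of residue fields. -/

instance Int.isJacobsonRing : IsJacobsonRing ℤ := by
  rw [isJacobsonRing_iff_prime_eq]
  intro P hP
  by_cases h : P = ⊥
  · subst h
    refine le_antisymm (fun x hx => ?_) Ideal.le_jacobson
    by_contra hx0
    -- A prime larger than |x| generates a maximal ideal that misses x.
    obtain ⟨p, hp, hpp⟩ := Nat.exists_infinite_primes (x.natAbs + 1)
    have hmax : (Ideal.span {(p : ℤ)}).IsMaximal :=
      PrincipalIdealRing.isMaximal_of_irreducible (Nat.prime_iff_prime_int.mp hpp).irreducible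
    have hmem := (Ideal.mem_sInf.mp hx) ⟨bot_le, hmax⟩
    rw [Ideal.mem_span_singleton] at hmem
    have := Nat.le_of_dvd (Int.natAbs_pos.mpr (by simpa using hx0)) (by simpa using Int.natAbs_dvd_natAbs.mpr hmem)
    omega
  · exact Ideal.jacobson_eq_self_of_isMaximal (H := hP.isMaximal h)

/-- By the Nullstellensatz over the Jacobson ring ℤ, K is a finite ℤ-module; characteristic 0 would
then make ℤ a field. -/
theorem Field.finite_of_finiteType_int (K : Type*) [Field K] [Algebra.FiniteType ℤ K] :
    Finite K := by
  have := finite_of_finite_type_of_isJacobsonRing ℤ K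
  obtain ⟨p, hp⟩ := CharP.exists K
  by_cases h0 : p = 0
  · subst h0
    have := CharP.charP_to_charZero K
    exact absurd (isField_of_isIntegral_of_isField (RingHom.injective_int (algebraMap ℤ K))
      (Field.toIsField K)) Int.not_isField
  · have := NeZero.mk h0
    let := ZMod.algebra K p
    have : Module.Finite (ZMod p) K := Module.Finite.of_restrictScalars_finite ℤ _ _
    exact Module.finite_of_finite (ZMod p)

theorem Field.finite_of_surjective_of_finiteType_int {A K : Type*} [CommRing A]
    [Algebra.FiniteType ℤ A] [Field K] (f : A →+* K) (hf : Function.Surjective f) : Finite K :=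
  have : Algebra.FiniteType ℤ K := .of_surjective f.toIntAlgHom hf
  Field.finite_of_finiteType_int K

/-! ### Counting homomorphisms to a finite field. -/

/-- Dedekind's independence of characters, transported to F^r: evaluation at the spanning family is
injective on B-linear maps, so it preserves linear independence. -/
theorem Nat.card_algHom_le_of_span {B A F : Type*} [CommRing B] [CommRing A] [Algebra B A] [Field F]
    [Algebra B F] {r : ℕ} (e : Fin r → A) (he : Submodule.span B (Set.range e) = ⊤) :
    Finite (A →ₐ[B] F) ∧ Nat.card (A →ₐ[B] F) ≤ r := by
  have hli : LinearIndependent F (fun (f : A →ₐ[B] F) (i : Fin r) => f (e i)) := by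
    have h1 : LinearIndependent F (fun f : A →ₐ[B] F => (f : A → F)) :=
      (linearIndependent_monoidHom A F).comp (fun f : A →ₐ[B] F => (f : A →* F))
        (fun f g h => AlgHom.ext fun a => DFunLike.congr_fun h a)
    have h2 : LinearIndependent F (fun f : A →ₐ[B] F => f.toLinearMap) := by
      refine LinearIndependent.of_comp (LinearMap.ltoFun B A F F) ?_
      exact h1
    let ev : (A →ₗ[B] F) →ₗ[F] (Fin r → F) :=
      { toFun := fun f i => f (e i), map_add' := fun _ _ => rfl, map_smul' := fun _ _ => rfl }
    refine h2.map' ev (LinearMap.ker_eq_bot.mpr fun f g h => ?_)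
    exact LinearMap.ext_on_range he fun i => congrFun h i
  have hfin := hli.finite
  have := Fintype.ofFinite (A →ₐ[B] F)
  exact ⟨hfin, by simpa using hli.fintype_card_le_finrank⟩

/-- The homomorphisms restricting to a given b : B → F are the B-algebra maps for the structure b
puts on F. The constant is the number of module generators, hence uniform in F. -/
theorem exists_card_ringHom_le_mul {B A : Type*} [CommRing B] [CommRing A] [Algebra B A]
    [Module.Finite B A] : ∃ r : ℕ, ∀ (F : Type u) [Field F] [Finite (B →+* F)],
    Finite (A →+* F) ∧ Nat.card (A →+* F) ≤ r * Nat.card (B →+* F) := by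
  obtain ⟨r, e, he⟩ := Module.Finite.exists_fin (R := B) (M := A)
  refine ⟨r, fun F _ _ => ?_⟩
  have key (b : B →+* F) : Finite {f : A →+* F // f.comp (algebraMap B A) = b} ∧
      Nat.card {f : A →+* F // f.comp (algebraMap B A) = b} ≤ r := by
    let := b.toAlgebra
    obtain ⟨h1, h2⟩ := Nat.card_algHom_le_of_span (F := F) e he
    let φ : {f : A →+* F // f.comp (algebraMap B A) = b} → (A →ₐ[B] F) :=
      fun f => { f.1 with commutes' := fun x => DFunLike.congr_fun f.2 x }
    have hφ : Function.Injective φ := fun f g h =>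
      Subtype.ext (RingHom.ext fun a => DFunLike.congr_fun h a)
    exact ⟨Finite.of_injective φ hφ, (Nat.card_le_card_of_injective φ hφ).trans h2⟩
  have hf (b : B →+* F) := (key b).1
  have E := Equiv.sigmaFiberEquiv (fun f : A →+* F => f.comp (algebraMap B A))
  have hfin : Finite (A →+* F) := Finite.of_equiv _ E
  refine ⟨hfin, ?_⟩
  have := Fintype.ofFinite (B →+* F)
  rw [← Nat.card_congr E, Nat.card_sigma]
  calc _ ≤ ∑ _b : B →+* F, r := Finset.sum_le_sum fun b _ => (key b).2
    _ = _ := by simp [mul_comm]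

theorem MvPolynomial.card_ringHom_le {d : ℕ} {S : Type*} [CommRing S] (F : Type*) [Field F] [Finite F]
    [Subsingleton (S →+* F)] : Finite (MvPolynomial (Fin d) S →+* F) ∧
    Nat.card (MvPolynomial (Fin d) S →+* F) ≤ Nat.card F ^ d := by
  let φ : (MvPolynomial (Fin d) S →+* F) → (Fin d → F) := fun f i => f (MvPolynomial.X i)
  have hφ : Function.Injective φ := fun f g h =>
    MvPolynomial.ringHom_ext' (Subsingleton.elim _ _) fun i => congrFun h i
  refine ⟨Finite.of_injective φ hφ, ?_⟩
  simpa [Nat.card_fun] using Nat.card_le_card_of_injective φ hφ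

theorem exists_card_ringHom_le_mul_pow {d : ℕ} {S A : Type*} [CommRing S] [CommRing A]
    [Algebra (MvPolynomial (Fin d) S) A] [Module.Finite (MvPolynomial (Fin d) S) A]
    (hS : ∀ (F : Type u) [Field F], Subsingleton (S →+* F)) :
    ∃ r : ℕ, ∀ (F : Type u) [Field F] [Finite F],
      Finite (A →+* F) ∧ Nat.card (A →+* F) ≤ r * Nat.card F ^ d := by
  obtain ⟨r, hr⟩ := exists_card_ringHom_le_mul (B := MvPolynomial (Fin d) S) (A := A)
  refine ⟨r, fun F _ _ => ?_⟩
  have := hS F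
  obtain ⟨h1, h2⟩ := MvPolynomial.card_ringHom_le (d := d) (S := S) F
  exact ⟨(hr F).1, (hr F).2.trans (Nat.mul_le_mul_left _ h2)⟩

/-- Finite fields of equal order are isomorphic, so all these quotient maps can be aimed at one
field A/m₀, and the kernel recovers m. Allowing A' ≠ A lets the count take place on a localization.
-/
theorem card_maximalSpectrum_le_card_ringHom {A A' : Type u} [CommRing A] [CommRing A']
    (j : A →+* A') (T : Set (MaximalSpectrum A)) (hfin : ∀ m ∈ T, Finite (A ⧸ m.asIdeal))
    (hT : ∀ m ∈ T, ∃ g : A' →+* A ⧸ m.asIdeal, g.comp j = Ideal.Quotient.mk m.asIdeal) {C d : ℕ}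
    (hC : ∀ (F : Type u) [Field F] [Finite F],
      Finite (A' →+* F) ∧ Nat.card (A' →+* F) ≤ C * Nat.card F ^ d) (q : ℕ) :
    ENat.card {m : T // Nat.card (A ⧸ m.1.asIdeal) = q} ≤ (C * q ^ d : ℕ) := by
  rcases isEmpty_or_nonempty {m : T // Nat.card (A ⧸ m.1.asIdeal) = q} with h | ⟨⟨⟨m₀, hm₀⟩, hq⟩⟩
  · rw [ENat.card_eq_zero_iff_empty _ |>.mpr h]; exact zero_le
  have := hfin m₀ hm₀
  let := Ideal.Quotient.field m₀.asIdeal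
  obtain ⟨h1, h2⟩ := hC (A ⧸ m₀.asIdeal)
  have key (m : {m : T // Nat.card (A ⧸ m.1.asIdeal) = q}) :
      ∃ f : A' →+* A ⧸ m₀.asIdeal, RingHom.ker (f.comp j) = m.1.1.asIdeal := by
    have := hfin m.1.1 m.1.2
    let := Ideal.Quotient.field m.1.1.asIdeal
    have := Fintype.ofFinite (A ⧸ m.1.1.asIdeal)
    have := Fintype.ofFinite (A ⧸ m₀.asIdeal)
    obtain ⟨g, hg⟩ := hT m.1.1 m.1.2
    let e : (A ⧸ m.1.1.asIdeal) ≃+* (A ⧸ m₀.asIdeal) := FiniteField.ringEquivOfCardEq (by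
      rw [Fintype.card_eq_nat_card, Fintype.card_eq_nat_card, hq, m.2])
    refine ⟨(e : _ →+* _).comp g, ?_⟩
    rw [RingHom.comp_assoc, hg]
    exact (RingHom.ker_equiv_comp (Ideal.Quotient.mk m.1.1.asIdeal) e).trans Ideal.mk_ker
  choose φ hφ using key
  have hinj : Function.Injective φ := fun a b h => by
    apply Subtype.ext; apply Subtype.ext; apply MaximalSpectrum.ext
    rw [← hφ a, ← hφ b, h]
  have hle := ENat.card_le_card_of_injective hinj
  refine hle.trans ?_
  rw [ENat.card_eq_coe_natCard]
  exact_mod_cast hq ▸ h2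

/-! ### From counting bounds to convergence. -/

/-- The map `e` lists the norms that can occur. It is used with k ↦ p^k, where the sparse values
save 1 in the abscissa, and with k ↦ k + 1. -/
theorem ENNReal.tsum_natCast_rpow_neg_le {ι κ : Type*} (N : ι → ℕ) (k : ι → κ) (e : κ → ℕ)
    (hN : ∀ i, N i = e (k i)) {C d : ℕ}
    (hC : ∀ q, ENat.card {i // N i = q} ≤ (C * q ^ d : ℕ)) (σ : ℝ) :
    ∑' i, (N i : ℝ≥0∞) ^ (-σ) ≤ C * ∑' j, (e j : ℝ≥0∞) ^ d * (e j : ℝ≥0∞) ^ (-σ) := by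
  rw [← ENNReal.tsum_fiberwise _ k, ← ENNReal.tsum_mul_left]
  refine ENNReal.tsum_le_tsum fun j => ?_
  have h1 : ∀ b : k ⁻¹' {j}, (N b : ℝ≥0∞) ^ (-σ) = (e j : ℝ≥0∞) ^ (-σ) := fun b => by
    rw [hN, show k b = j from b.2]
  simp_rw [h1]
  rw [ENNReal.tsum_const, ← mul_assoc]
  refine mul_le_mul_left ?_ _
  have h2 : ENat.card (k ⁻¹' {j}) ≤ (C * e j ^ d : ℕ) := by
    refine le_trans (ENat.card_le_card_of_injective
      (f := fun b : k ⁻¹' {j} => (⟨b.1, by rw [hN, show k b = j from b.2]⟩ : {i // N i = e j}))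
      fun a b h => Subtype.ext (congrArg (fun x => x.1) h)) (hC _)
  calc ((ENat.card (k ⁻¹' {j}) : ℕ∞) : ℝ≥0∞) ≤ (((C * e j ^ d : ℕ) : ℕ∞) : ℝ≥0∞) := by
        exact_mod_cast h2
    _ = _ := by push_cast; rfl

theorem ENNReal.natCast_pow_mul_rpow_neg {q d : ℕ} (hq : q ≠ 0) (σ : ℝ) :
    (q : ℝ≥0∞) ^ d * (q : ℝ≥0∞) ^ (-σ) = ENNReal.ofReal ((q : ℝ) ^ ((d : ℝ) - σ)) := by
  rw [← ENNReal.rpow_natCast, ← ENNReal.rpow_add _ _ (by exact_mod_cast hq) (by simp),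
    ← ENNReal.ofReal_natCast, ENNReal.ofReal_rpow_of_pos (by positivity), sub_eq_add_neg]

theorem ENNReal.tsum_prime_pow_ne_top {p : ℕ} (hp : p.Prime) {d : ℕ} {σ : ℝ} (h : d < σ) :
    ∑' k : ℕ, ((p ^ k : ℕ) : ℝ≥0∞) ^ d * ((p ^ k : ℕ) : ℝ≥0∞) ^ (-σ) ≠ ⊤ := by
  have h1 (k : ℕ) : ((p ^ k : ℕ) : ℝ≥0∞) ^ d * ((p ^ k : ℕ) : ℝ≥0∞) ^ (-σ) =
      ENNReal.ofReal (((p : ℝ) ^ ((d : ℝ) - σ)) ^ k) := by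
    rw [ENNReal.natCast_pow_mul_rpow_neg (pow_ne_zero _ hp.ne_zero)]
    congr 1
    push_cast
    rw [← Real.rpow_natCast, ← Real.rpow_mul (by positivity), ← Real.rpow_natCast,
      ← Real.rpow_mul (by positivity), mul_comm]
  simp_rw [h1]
  refine (summable_geometric_of_lt_one (by positivity) ?_).tsum_ofReal_ne_top
  exact Real.rpow_lt_one_of_one_lt_of_neg (by exact_mod_cast hp.one_lt) (by linarith)

theorem ENNReal.tsum_nat_ne_top {d : ℕ} {σ : ℝ} (h : d + 1 < σ) :
    ∑' k : ℕ, ((k + 1 : ℕ) : ℝ≥0∞) ^ d * ((k + 1 : ℕ) : ℝ≥0∞) ^ (-σ) ≠ ⊤ := by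
  simp_rw [fun k : ℕ => ENNReal.natCast_pow_mul_rpow_neg (d := d) (Nat.succ_ne_zero k) σ]
  refine Summable.tsum_ofReal_ne_top ?_
  exact (summable_nat_add_iff 1).mpr (Real.summable_nat_rpow.mpr (by linarith))

/-! ### Finite covers and sums over maximal ideals. -/

theorem ENNReal.tsum_ne_top_of_cover {ι J : Type*} [Finite J] (T : J → Set ι)
    (hT : ∀ i, ∃ j, i ∈ T j) (g : ι → ℝ≥0∞) (hg : ∀ j, ∑' i : T j, g i ≠ ⊤) : ∑' i, g i ≠ ⊤ := by
  have hsurj : Function.Surjective (fun x : Σ j, T j => (x.2 : ι)) := fun i => by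
    obtain ⟨j, hj⟩ := hT i
    exact ⟨⟨j, i, hj⟩, rfl⟩
  refine ne_top_of_le_ne_top ?_ (ENNReal.tsum_le_tsum_comp_of_surjective hsurj g)
  have := Fintype.ofFinite J
  rw [ENNReal.tsum_sigma', tsum_fintype]
  exact ENNReal.sum_ne_top.mpr fun j _ => hg j

/-- The sum of `|A ⧸ m| ^ (-σ)` over the maximal ideals `m` of `A`. -/
noncomputable def maximalIdealSum (A : Type*) [CommRing A] (σ : ℝ) : ℝ≥0∞ :=
  ∑' m : MaximalSpectrum A, (Nat.card (A ⧸ m.asIdeal) : ℝ≥0∞) ^ (-σ)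

theorem tsum_le_maximalIdealSum_quotient {A : Type*} [CommRing A] (I : Ideal A) (σ : ℝ) :
    ∑' m : {m : MaximalSpectrum A | I ≤ m.asIdeal}, (Nat.card (A ⧸ m.1.asIdeal) : ℝ≥0∞) ^ (-σ) ≤
      maximalIdealSum (A ⧸ I) σ := by
  have hm (m : {m : MaximalSpectrum A | I ≤ m.asIdeal}) :
      (m.1.asIdeal.map (Ideal.Quotient.mk I)).comap (Ideal.Quotient.mk I) = m.1.asIdeal := by
    rw [Ideal.comap_map_of_surjective _ Ideal.Quotient.mk_surjective, ← RingHom.ker_eq_comap_bot,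
      Ideal.mk_ker, sup_eq_left]
    exact m.2
  let φ : {m : MaximalSpectrum A | I ≤ m.asIdeal} → MaximalSpectrum (A ⧸ I) := fun m =>
    ⟨m.1.asIdeal.map (Ideal.Quotient.mk I), by
      refine (Ideal.map_eq_top_or_isMaximal_of_surjective _ Ideal.Quotient.mk_surjective
        m.1.isMaximal).resolve_left fun h => m.1.isMaximal.ne_top ?_
      rw [← hm m, h, Ideal.comap_top]⟩
  have hφ : Function.Injective φ := fun a b h => by
    apply Subtype.ext
    apply MaximalSpectrum.ext
    rw [← hm a, ← hm b, show a.1.asIdeal.map (Ideal.Quotient.mk I) = _ from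
      congrArg MaximalSpectrum.asIdeal h]
  refine le_trans (le_of_eq ?_) (ENNReal.tsum_comp_le_tsum_of_injective hφ _)
  refine tsum_congr fun m => ?_
  rw [Nat.card_congr (DoubleQuot.quotQuotEquivQuotOfLE m.2).toEquiv]

/-- Every maximal ideal contains one of the finitely many minimal primes. -/
theorem maximalIdealSum_ne_top_of_forall_isPrime {A : Type*} [CommRing A] [IsNoetherianRing A]
    {σ : ℝ} (h : ∀ I : Ideal A, I.IsPrime → maximalIdealSum (A ⧸ I) σ ≠ ⊤) :
    maximalIdealSum A σ ≠ ⊤ := by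
  have := (minimalPrimes.finite_of_isNoetherianRing A).to_subtype
  refine ENNReal.tsum_ne_top_of_cover
    (fun I : minimalPrimes A => {m : MaximalSpectrum A | I.1 ≤ m.asIdeal}) (fun m => ?_) _
    fun I => ne_top_of_le_ne_top (h I I.2.1.1) (tsum_le_maximalIdealSum_quotient _ _)
  obtain ⟨p, hp, hpm⟩ := Ideal.exists_minimalPrimes_le (I := (⊥ : Ideal A)) (J := m.asIdeal) bot_le
  exact ⟨⟨p, hp⟩, hpm⟩

theorem Ideal.Quotient.finite_of_isMaximal_of_finiteType_int {A : Type*} [CommRing A]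
    [Algebra.FiniteType ℤ A] (m : Ideal A) [m.IsMaximal] : Finite (A ⧸ m) := by
  let := Ideal.Quotient.field m
  exact Field.finite_of_surjective_of_finiteType_int (Ideal.Quotient.mk m) Ideal.Quotient.mk_surjective

/-! ### Convergence in characteristic p. -/

theorem maximalIdealSum_ne_top_of_algebra_zmod_of_isDomain {p : ℕ} (hp : p.Prime) {A : Type u}
    [CommRing A] [IsDomain A] [Algebra (ZMod p) A] [Algebra.FiniteType (ZMod p) A] {d : ℕ}
    (hd : ringKrullDim A ≤ d) {σ : ℝ} (hσ : d < σ) : maximalIdealSum A σ ≠ ⊤ := by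
  have := Fact.mk hp
  have : Algebra.FiniteType ℤ A := .trans (S := ZMod p) inferInstance inferInstance
  obtain ⟨n, g, hg, hfin⟩ := exists_finite_inj_algHom_of_fg (ZMod p) A
  let := g.toRingHom.toAlgebra
  have : Module.Finite (MvPolynomial (Fin n) (ZMod p)) A := hfin
  -- The polynomial ring has dimension n, and A is integral over it.
  have hn : n ≤ d := by
    have h1 := ringKrullDim_le_of_isIntegral_of_injective (MvPolynomial (Fin n) (ZMod p)) A hg
    rw [MvPolynomial.ringKrullDim_of_isNoetherianRing, ringKrullDim_eq_zero_of_field, zero_add,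
      Nat.card_fin] at h1
    exact_mod_cast h1.trans hd
  obtain ⟨C, hC⟩ := exists_card_ringHom_le_mul_pow (d := n) (S := ZMod p) (A := A)
    fun F _ => inferInstance
  have hcard := card_maximalSpectrum_le_card_ringHom (RingHom.id A) Set.univ
    (fun m _ => Ideal.Quotient.finite_of_isMaximal_of_finiteType_int m.asIdeal)
    (fun m _ => ⟨Ideal.Quotient.mk _, RingHom.comp_id _⟩) hC
  have hcard' (q : ℕ) : ENat.card {m : MaximalSpectrum A // Nat.card (A ⧸ m.asIdeal) = q} ≤
      (C * q ^ n : ℕ) :=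
    (ENat.card_le_card_of_injective
      (f := fun m : {m : MaximalSpectrum A // Nat.card (A ⧸ m.asIdeal) = q} =>
      (⟨⟨m.1, trivial⟩, m.2⟩ : {m : (Set.univ : Set (MaximalSpectrum A)) // Nat.card (A ⧸ m.1.asIdeal) = q}))
      fun a b h => Subtype.ext (congrArg (fun x => x.1.1) h)).trans (hcard q)
  refine ne_top_of_le_ne_top ?_ (ENNReal.tsum_natCast_rpow_neg_le _
    (fun m => Module.finrank (ZMod p) (A ⧸ m.asIdeal)) (fun k => p ^ k) (fun m => ?_) hcard' σ)
  · exact ENNReal.mul_ne_top (by simp)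
      (ENNReal.tsum_prime_pow_ne_top hp (lt_of_le_of_lt (by exact_mod_cast hn) hσ))
  · have := Ideal.Quotient.finite_of_isMaximal_of_finiteType_int m.asIdeal
    exact (FiniteField.pow_finrank_eq_natCard p _).symm

theorem maximalIdealSum_ne_top_of_algebra_zmod {p : ℕ} (hp : p.Prime) {A : Type u}
    [CommRing A] [Algebra (ZMod p) A] [Algebra.FiniteType (ZMod p) A] {d : ℕ}
    (hd : ringKrullDim A ≤ d) {σ : ℝ} (hσ : d < σ) : maximalIdealSum A σ ≠ ⊤ := by
  have := Fact.mk hp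
  have := Algebra.FiniteType.isNoetherianRing (ZMod p) A
  exact maximalIdealSum_ne_top_of_forall_isPrime fun I hI =>
    maximalIdealSum_ne_top_of_algebra_zmod_of_isDomain hp ((ringKrullDim_quotient_le I).trans hd) hσ

/-! ### Convergence in characteristic zero. -/

/-- Noether normalization over a dense open subset of `Spec ℤ`. -/
theorem exists_mvPolynomial_int_isIntegralElem_of_injective {A Q : Type*} [CommRing A]
    [Algebra.FiniteType ℤ A] [Field Q] [CharZero Q] [Algebra A Q]
    (hAQ : Function.Injective (algebraMap A Q)) :
    ∃ (d : ℕ) (φ : MvPolynomial (Fin d) ℤ →+* A) (f : ℕ), Function.Injective φ ∧ f ≠ 0 ∧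
      ∀ a : A, ∃ k : ℕ, φ.IsIntegralElem ((f : A) ^ k * a) := by
  obtain ⟨s, hs⟩ := Algebra.FiniteType.out (R := ℤ) (A := A)
  -- K plays the role of A ⊗ ℚ. Normalize it over ℚ, then clear denominators, first in the variables
  -- and then in the integral equations.
  let K : Subalgebra ℚ Q := Algebra.adjoin ℚ (algebraMap A Q '' s)
  have hKfg : Algebra.FiniteType ℚ K :=
    (Subalgebra.fg_iff_finiteType K).mp (Subalgebra.fg_def.mpr ⟨_, s.finite_toSet.image _, rfl⟩)
  have hmem (a : A) : algebraMap A Q a ∈ K := by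
    have : a ∈ Algebra.adjoin ℤ (s : Set A) := hs ▸ Algebra.mem_top
    induction this using Algebra.adjoin_induction with
    | mem x hx => exact Algebra.subset_adjoin ⟨x, hx, rfl⟩
    | algebraMap r => simp
    | add x y _ _ hx hy => simpa using add_mem hx hy
    | mul x y _ _ hx hy => simpa using mul_mem hx hy
  have hmul (x : Q) (hx : x ∈ K) : ∃ n : ℕ, n ≠ 0 ∧ ∃ a : A, algebraMap A Q a = n * x := by
    induction hx using Algebra.adjoin_induction with
    | mem x hx => obtain ⟨a, -, rfl⟩ := hx; exact ⟨1, one_ne_zero, a, by simp⟩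
    | algebraMap r =>
      refine ⟨r.den, r.den_nz, r.num, ?_⟩
      rw [map_intCast, eq_ratCast]
      have := Rat.den_mul_eq_num r
      exact_mod_cast (congrArg (fun x : ℚ => (x : Q)) this).symm
    | add x y _ _ hx hy =>
      obtain ⟨n, hn, a, ha⟩ := hx
      obtain ⟨m, hm, b, hb⟩ := hy
      exact ⟨n * m, mul_ne_zero hn hm, m * a + n * b, by simp [ha, hb]; ring⟩
    | mul x y _ _ hx hy =>
      obtain ⟨n, hn, a, ha⟩ := hx
      obtain ⟨m, hm, b, hb⟩ := hy
      exact ⟨n * m, mul_ne_zero hn hm, a * b, by simp [ha, hb]; ring⟩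
  obtain ⟨d, g, hg, hgint⟩ := exists_integral_inj_algHom_of_fg ℚ K
  choose n hn0 b hb using fun i : Fin d => hmul (g (MvPolynomial.X i)) (g (MvPolynomial.X i)).2
  -- rescale the variables
  let ρ : MvPolynomial (Fin d) ℚ →ₐ[ℚ] MvPolynomial (Fin d) ℚ :=
    MvPolynomial.aeval fun i => MvPolynomial.C (n i : ℚ) * MvPolynomial.X i
  let ρ' : MvPolynomial (Fin d) ℚ →ₐ[ℚ] MvPolynomial (Fin d) ℚ :=
    MvPolynomial.aeval fun i => MvPolynomial.C (n i : ℚ)⁻¹ * MvPolynomial.X i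
  have hρ₁ : ρ.comp ρ' = AlgHom.id ℚ _ := by
    refine MvPolynomial.algHom_ext fun i => ?_
    have : (n i : ℚ) ≠ 0 := by exact_mod_cast hn0 i
    simp [ρ, ρ', ← mul_assoc, MvPolynomial.algebraMap_eq, ← MvPolynomial.C_mul, this, -map_natCast]
  have hρ₂ : ρ'.comp ρ = AlgHom.id ℚ _ := by
    refine MvPolynomial.algHom_ext fun i => ?_
    have : (n i : ℚ) ≠ 0 := by exact_mod_cast hn0 i
    simp [ρ, ρ', ← mul_assoc, MvPolynomial.algebraMap_eq, ← MvPolynomial.C_mul, this, -map_natCast]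
  let h : MvPolynomial (Fin d) ℚ →ₐ[ℚ] K := g.comp ρ
  have hinj : Function.Injective h := hg.comp
    (Function.LeftInverse.injective (g := ρ') fun x => DFunLike.congr_fun hρ₂ x)
  have hint : h.toRingHom.IsIntegral := by
    refine RingHom.IsIntegral.trans ρ.toRingHom g.toRingHom (RingHom.isIntegral_of_surjective _ ?_) hgint
    exact Function.RightInverse.surjective (g := ρ') fun x => DFunLike.congr_fun hρ₁ x
  let φ : MvPolynomial (Fin d) ℤ →+* A := (MvPolynomial.aeval b).toRingHom
  have hcomm : (algebraMap A Q).comp φ =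
      (K.val.toRingHom.comp h.toRingHom).comp (MvPolynomial.map (Int.castRingHom ℚ)) := by
    refine MvPolynomial.ringHom_ext' (RingHom.ext_int _ _) fun i => ?_
    simp [φ, h, ρ, hb]
  have hφ : Function.Injective φ := by
    have h1 : Function.Injective ((algebraMap A Q).comp φ) := by
      rw [hcomm]
      exact (Subtype.val_injective.comp hinj).comp
        (MvPolynomial.map_injective _ (RingHom.injective_int _))
    exact Function.Injective.of_comp (f := algebraMap A Q) h1
  let _ := φ.toAlgebra
  let _ := (K.val.toRingHom.comp h.toRingHom).toAlgebra
  let _ : Algebra (MvPolynomial (Fin d) ℤ) Q := ((algebraMap A Q).comp φ).toAlgebra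
  have : IsScalarTower (MvPolynomial (Fin d) ℤ) (MvPolynomial (Fin d) ℚ) Q := .of_algebraMap_eq' hcomm
  have : IsScalarTower (MvPolynomial (Fin d) ℤ) A Q := .of_algebraMap_eq' rfl
  have hmult (a : A) : ∃ m : ℕ, m ≠ 0 ∧ IsIntegral (MvPolynomial (Fin d) ℤ) ((m : A) * a) := by
    have h1 : IsIntegral (MvPolynomial (Fin d) ℚ) (algebraMap A Q a) :=
      RingHom.IsIntegralElem.map (g := K.val.toRingHom) (hint ⟨algebraMap A Q a, hmem a⟩)
    obtain ⟨⟨_, m, hm, rfl⟩, hx⟩ := IsIntegral.exists_multiple_integral_of_isLocalization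
      ((nonZeroDivisors ℤ).map MvPolynomial.C) (R := MvPolynomial (Fin d) ℤ) _ h1
    have hm0 : m ≠ 0 := nonZeroDivisors.ne_zero hm
    have h2 : IsIntegral (MvPolynomial (Fin d) ℤ) (m * a : A) := by
      refine (isIntegral_algebraMap_iff hAQ).mp ?_
      have e : algebraMap A Q (m * a) =
          (MvPolynomial.C m : MvPolynomial (Fin d) ℤ) • algebraMap A Q a := by
        rw [Algebra.smul_def, IsScalarTower.algebraMap_apply (MvPolynomial (Fin d) ℤ) A Q, ← map_mul]
        congr 2
        exact (map_intCast φ m).symm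
      rw [e]
      exact hx
    refine ⟨m.natAbs, by simpa using hm0, ?_⟩
    rcases Int.natAbs_eq m with h | h
    · rw [h] at h2
      simpa using h2
    · rw [h] at h2
      simpa using h2.neg
  choose m hm0 hm using hmult
  have hnat (c : ℕ) : IsIntegral (MvPolynomial (Fin d) ℤ) (c : A) := by
    simpa using (isIntegral_algebraMap (R := MvPolynomial (Fin d) ℤ) (A := A) (x := (c : _)))
  -- Multiplication by f makes each generator integral; a product of generators needs a higher
  -- power, hence the exponent k depending on a.
  refine ⟨d, φ, ∏ t ∈ s, m t, hφ, Finset.prod_ne_zero_iff.mpr fun t _ => hm0 t, fun a => ?_⟩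
  change ∃ k : ℕ, IsIntegral (MvPolynomial (Fin d) ℤ) (((∏ t ∈ s, m t : ℕ) : A) ^ k * a)
  have : a ∈ Algebra.adjoin ℤ (s : Set A) := hs ▸ Algebra.mem_top
  induction this using Algebra.adjoin_induction with
  | mem x hx =>
    refine ⟨1, ?_⟩
    obtain ⟨c, hc⟩ := Finset.dvd_prod_of_mem m (show x ∈ s from hx)
    rw [pow_one, hc]
    have := (hnat c).mul (hm x)
    convert this using 1
    push_cast
    ring
  | algebraMap r =>
    refine ⟨0, ?_⟩
    simpa using (isIntegral_algebraMap (R := MvPolynomial (Fin d) ℤ) (A := A) (x := (r : _)))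
  | add x y _ _ hx hy =>
    obtain ⟨k, hk⟩ := hx
    obtain ⟨l, hl⟩ := hy
    refine ⟨k + l, ?_⟩
    convert ((hnat (∏ t ∈ s, m t)).pow l |>.mul hk).add (((hnat (∏ t ∈ s, m t)).pow k).mul hl) using 1
    ring
  | mul x y _ _ hx hy =>
    obtain ⟨k, hk⟩ := hx
    obtain ⟨l, hl⟩ := hy
    refine ⟨k + l, ?_⟩
    convert hk.mul hl using 1
    ring

theorem exists_mvPolynomial_int_isIntegralElem (A : Type*) [CommRing A] [IsDomain A] [CharZero A]
    [Algebra.FiniteType ℤ A] :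
    ∃ (d : ℕ) (φ : MvPolynomial (Fin d) ℤ →+* A) (f : ℕ), Function.Injective φ ∧ f ≠ 0 ∧
      ∀ a : A, ∃ k : ℕ, φ.IsIntegralElem ((f : A) ^ k * a) :=
  have : CharZero (FractionRing A) :=
    charZero_of_injective_algebraMap (IsFractionRing.injective A (FractionRing A))
  exists_mvPolynomial_int_isIntegralElem_of_injective (IsFractionRing.injective A (FractionRing A))

/-- A prime p > f stays a nonunit in ℤ[1/f], so this domain is not a field. -/
theorem Int.one_le_ringKrullDim_of_isLocalizationAway {f : ℕ} (hf : f ≠ 0) (S : Type*) [CommRing S]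
    [Algebra ℤ S] [IsLocalization.Away (f : ℤ) S] : 1 ≤ ringKrullDim S := by
  have hle : Submonoid.powers (f : ℤ) ≤ nonZeroDivisors ℤ :=
    powers_le_nonZeroDivisors_of_noZeroDivisors (by exact_mod_cast hf)
  have : IsDomain S := IsLocalization.isDomain_of_le_nonZeroDivisors S hle
  have hfield : ¬ IsField S := fun hfield => by
    obtain ⟨p, hfp, hp⟩ := Nat.exists_infinite_primes (f + 1)
    have h1 : algebraMap ℤ S p ≠ 0 := by
      rw [Ne, map_eq_zero_iff _ (IsLocalization.injective S hle)]
      exact_mod_cast hp.ne_zero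
    obtain ⟨x, hx⟩ := hfield.mul_inv_cancel h1
    obtain ⟨n, b, hb⟩ := (IsLocalization.Away.algebraMap_isUnit_iff (f : ℤ)).mp
      (IsUnit.of_mul_eq_one x hx)
    have h3 : p ∣ f ^ n := by
      rw [← Int.natCast_dvd_natCast]
      exact ⟨b, by rw [← hb]; push_cast; rfl⟩
    exact absurd (Nat.le_of_dvd (Nat.pos_of_ne_zero hf) (hp.dvd_of_dvd_pow h3)) (by omega)
  obtain ⟨p, hp, hprime⟩ := Ring.not_isField_iff_exists_prime.mp hfield
  exact Order.one_le_krullDim_iff.mpr ⟨⟨⊥, Ideal.isPrime_bot⟩, ⟨p, hprime⟩, (bot_lt_iff_ne_bot.mpr hp : ⊥ < p)⟩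

theorem exists_injective_finite_mvPolynomial_of_isLocalizationAway {A : Type*} [CommRing A]
    [Algebra.FiniteType ℤ A] {d f : ℕ} {φ : MvPolynomial (Fin d) ℤ →+* A}
    (hφ : Function.Injective φ) (hint : ∀ a : A, ∃ k : ℕ, φ.IsIntegralElem ((f : A) ^ k * a))
    (S A' : Type*) [CommRing S] [CommRing A'] [Algebra ℤ S] [Algebra A A']
    [IsLocalization.Away (f : ℤ) S] [IsLocalization.Away (f : A) A'] :
    ∃ ψ : MvPolynomial (Fin d) S →+* A', Function.Injective ψ ∧ ψ.Finite := by
  let M : Submonoid (MvPolynomial (Fin d) ℤ) := (Submonoid.powers (f : ℤ)).map MvPolynomial.C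
  have hM : M = Submonoid.powers (f : MvPolynomial (Fin d) ℤ) := by
    simp [M, Submonoid.map_powers]
  have hle : M ≤ (Submonoid.powers (f : A)).comap φ := by
    rw [hM, Submonoid.powers_le]
    exact ⟨1, by simp⟩
  have hMA : M.map φ = Submonoid.powers (f : A) := by
    rw [hM, Submonoid.map_powers, map_natCast]
  have : IsLocalization (M.map φ) A' := by rw [hMA]; infer_instance
  let ψ : MvPolynomial (Fin d) S →+* A' := IsLocalization.map (M := M) A' φ hle
  have hψφ : ψ.comp (algebraMap _ _) = (algebraMap A A').comp φ := IsLocalization.map_comp hle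
  have hψint : ψ.IsIntegral := by
    intro x
    obtain ⟨n, a, ha⟩ := IsLocalization.Away.surj (f : A) x
    obtain ⟨k, hk⟩ := hint a
    obtain ⟨u, hu⟩ := (IsLocalization.Away.algebraMap_isUnit (S := S) (f : ℤ)).exists_left_inv
    have huf : ψ (MvPolynomial.C u) * (f : A') = 1 := by
      have := congrArg (fun s : S => ψ (MvPolynomial.C s)) hu
      simpa using this
    have h1 : ψ.IsIntegralElem (algebraMap A A' (f ^ k * a)) := by
      have h2 : ((algebraMap A A').comp φ).IsIntegralElem (algebraMap A A' (f ^ k * a)) := hk.map _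
      rw [← hψφ] at h2
      exact h2.of_comp
    -- Here u = 1/f in S and x fⁿ = a, so x is a power of u, which lies in the image of ψ, times the
    -- integral element f^k a.
    have h3 : x = ψ (MvPolynomial.C u) ^ (k + n) * algebraMap A A' (f ^ k * a) := by
      rw [map_natCast] at ha
      rw [map_mul, ← ha, map_pow, map_natCast]
      calc x = (ψ (MvPolynomial.C u) * f) ^ (k + n) * x := by rw [huf, one_pow, one_mul]
        _ = _ := by ring
    rw [h3, ← map_pow]
    exact (ψ.isIntegralElem_map).mul ψ h1
  refine ⟨ψ, IsLocalization.map_injective_of_injective M _ _ hφ, hψint.to_finite ?_⟩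
  refine RingHom.FiniteType.of_comp_finiteType (f := (algebraMap ℤ (MvPolynomial (Fin d) S))) ?_
  have h1 : (algebraMap A A').FiniteType := RingHom.finiteType_algebraMap.mpr
    (IsLocalization.finiteType_of_monoid_fg (Submonoid.powers (f : A)) A')
  have h2 : (algebraMap ℤ A).FiniteType := RingHom.finiteType_algebraMap.mpr inferInstance
  rw [RingHom.ext_int (ψ.comp (algebraMap ℤ (MvPolynomial (Fin d) S)))
    ((algebraMap A A').comp (algebraMap ℤ A))]
  exact h1.comp h2

theorem maximalIdealSum_ne_top_of_charZero_of_isDomain {A : Type u} [CommRing A] [IsDomain A]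
    [CharZero A] [Algebra.FiniteType ℤ A] {d : ℕ} (hd : ringKrullDim A ≤ d) {σ : ℝ} (hσ : d < σ) :
    maximalIdealSum A σ ≠ ⊤ := by
  obtain ⟨n, φ, f, hφ, hf, hint⟩ := exists_mvPolynomial_int_isIntegralElem A
  let S := Localization.Away (f : ℤ)
  let A' := Localization.Away (f : A)
  obtain ⟨ψ, hψ, hψfin⟩ := exists_injective_finite_mvPolynomial_of_isLocalizationAway hφ hint S A'
  let := ψ.toAlgebra
  have : Module.Finite (MvPolynomial (Fin n) S) A' := hψfin
  have : IsNoetherianRing S := IsLocalization.isNoetherianRing (Submonoid.powers (f : ℤ)) S inferInstance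
  -- The base ℤ[1/f] contributes at least 1 to the dimension, paying for the sum over all integers
  -- q.
  have hn : n + 1 ≤ d := by
    have h1 := (ringKrullDim_le_of_isIntegral_of_injective (MvPolynomial (Fin n) S) A' hψ).trans
      ((ringKrullDim_le_of_isLocalization A' (Submonoid.powers (f : A))).trans hd)
    rw [MvPolynomial.ringKrullDim_of_isNoetherianRing, Nat.card_fin, add_comm] at h1
    exact_mod_cast (add_le_add_right (Int.one_le_ringKrullDim_of_isLocalizationAway hf S) (n : WithBot ℕ∞)).trans h1
  -- `none` collects the m avoiding f, `some p` those lying over the prime p ∣ f.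
  refine ENNReal.tsum_ne_top_of_cover (J := Option f.primeFactors) (fun j => j.elim
    {m : MaximalSpectrum A | (f : A) ∉ m.asIdeal}
    (fun p => {m : MaximalSpectrum A | Ideal.span {((p : ℕ) : A)} ≤ m.asIdeal})) (fun m => ?_) _ ?_
  · by_cases hm : (f : A) ∈ m.asIdeal
    · let := Ideal.Quotient.field m.asIdeal
      obtain ⟨p, hp⟩ := CharP.exists (A ⧸ m.asIdeal)
      have hpf : p ∣ f := by
        rw [← CharP.cast_eq_zero_iff (A ⧸ m.asIdeal), ← map_natCast (Ideal.Quotient.mk m.asIdeal)]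
        exact Ideal.Quotient.eq_zero_iff_mem.mpr hm
      have hpp : p.Prime := (CharP.char_is_prime_or_zero (A ⧸ m.asIdeal) p).resolve_right
        fun h => hf (zero_dvd_iff.mp (h ▸ hpf))
      refine ⟨some ⟨p, Nat.mem_primeFactors.mpr ⟨hpp, hpf, hf⟩⟩, ?_⟩
      change Ideal.span {(p : A)} ≤ m.asIdeal
      rw [Ideal.span_singleton_le_iff_mem, ← Ideal.Quotient.eq_zero_iff_mem, map_natCast]
      exact CharP.cast_eq_zero _ _
    · exact ⟨none, hm⟩
  · rintro (_ | ⟨p, hp⟩)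
    · obtain ⟨C, hC⟩ := exists_card_ringHom_le_mul_pow (d := n) (S := S)
        (A := A') fun F _ => ⟨fun a b => IsLocalization.ringHom_ext (Submonoid.powers (f : ℤ))
          (RingHom.ext_int _ _)⟩
      have hcard := card_maximalSpectrum_le_card_ringHom (algebraMap A A')
        {m : MaximalSpectrum A | (f : A) ∉ m.asIdeal}
        (fun m _ => Ideal.Quotient.finite_of_isMaximal_of_finiteType_int m.asIdeal)
        (fun m hm => by
          let := Ideal.Quotient.field m.asIdeal
          have hu : IsUnit (Ideal.Quotient.mk m.asIdeal (f : A)) :=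
            IsUnit.mk0 _ fun h => hm (Ideal.Quotient.eq_zero_iff_mem.mp h)
          exact ⟨IsLocalization.Away.lift (f : A) hu, IsLocalization.Away.lift_comp _ hu⟩) hC
      -- Indexing by q - 1 keeps q = 0 out of the sum, since 0^(-σ) = ⊤.
      refine ne_top_of_le_ne_top ?_ (ENNReal.tsum_natCast_rpow_neg_le _
        (fun m => Nat.card (A ⧸ m.1.asIdeal) - 1) (fun k => k + 1) (fun m => ?_) hcard σ)
      · refine ENNReal.mul_ne_top (by simp) (ENNReal.tsum_nat_ne_top (lt_of_le_of_lt ?_ hσ))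
        exact_mod_cast hn
      · have := Ideal.Quotient.finite_of_isMaximal_of_finiteType_int m.1.asIdeal
        exact (Nat.succ_pred_eq_of_pos Nat.card_pos).symm
    · have hpp := Nat.prime_of_mem_primeFactors hp
      refine ne_top_of_le_ne_top ?_ (tsum_le_maximalIdealSum_quotient _ σ)
      let I : Ideal A := Ideal.span {(p : A)}
      -- The characteristic c is p, or 1 when A/I is the zero ring; c ∣ p handles both cases.
      obtain ⟨c, hc⟩ := CharP.exists (A ⧸ I)
      have hcp : c ∣ p := by
        rw [← CharP.cast_eq_zero_iff (A ⧸ I), ← map_natCast (Ideal.Quotient.mk I)]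
        exact Ideal.Quotient.eq_zero_iff_mem.mpr (Ideal.mem_span_singleton_self _)
      let := ZMod.algebra' (A ⧸ I) c hcp
      have : Algebra.FiniteType ℤ (A ⧸ I) :=
        .of_surjective (Ideal.Quotient.mk I).toIntAlgHom Ideal.Quotient.mk_surjective
      have : Algebra.FiniteType (ZMod p) (A ⧸ I) := .of_restrictScalars_finiteType ℤ _ _
      exact maximalIdealSum_ne_top_of_algebra_zmod hpp ((ringKrullDim_quotient_le I).trans hd) hσ

theorem maximalIdealSum_ne_top {A : Type u} [CommRing A] [Algebra.FiniteType ℤ A] {d : ℕ}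
    (hd : ringKrullDim A ≤ d) {σ : ℝ} (hσ : d < σ) : maximalIdealSum A σ ≠ ⊤ := by
  have := Algebra.FiniteType.isNoetherianRing ℤ A
  refine maximalIdealSum_ne_top_of_forall_isPrime fun I hI => ?_
  have hdI := (ringKrullDim_quotient_le I).trans hd
  have : @Algebra.FiniteType ℤ (A ⧸ I) _ _ (Ring.toIntAlgebra _) :=
    .of_surjective (Ideal.Quotient.mk I).toIntAlgHom Ideal.Quotient.mk_surjective
  obtain ⟨p, hp⟩ := CharP.exists (A ⧸ I)
  rcases CharP.char_is_prime_or_zero (A ⧸ I) p with h | rfl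
  · let := ZMod.algebra (A ⧸ I) p
    have : Algebra.FiniteType (ZMod p) (A ⧸ I) := Algebra.FiniteType.of_restrictScalars_finiteType ℤ _ _
    exact maximalIdealSum_ne_top_of_algebra_zmod h hdI hσ
  · have := CharP.charP_to_charZero (A ⧸ I)
    exact maximalIdealSum_ne_top_of_charZero_of_isDomain hdI hσ

/-! ### Expanding an Euler product over finitely supported exponents. -/

section EulerProduct

variable {ι : Type*}

/-- Finitely supported functions with support in `insert a s`, split at `a`. -/
noncomputable def Finsupp.supportInsertEquiv [DecidableEq ι] {a : ι} {s : Finset ι} (ha : a ∉ s) :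
    ℕ × {c : ι →₀ ℕ // c.support ⊆ s} ≃ {c : ι →₀ ℕ // c.support ⊆ insert a s} where
  toFun x := ⟨Finsupp.single a x.1 + x.2.1, by
    refine Finsupp.support_add.trans (Finset.union_subset ?_ (x.2.2.trans (Finset.subset_insert _ _)))
    exact Finsupp.support_single_subset.trans (by simp)⟩
  invFun c := ⟨c.1 a, c.1.erase a, by
    rw [Finsupp.support_erase, ← Finset.subset_insert_iff]
    exact c.2⟩
  left_inv x := by
    have h : x.2.1 a = 0 := Finsupp.notMem_support_iff.mp fun h => ha (x.2.2 h)
    ext i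
    · simp [h]
    · rcases eq_or_ne i a with rfl | hi
      · simp [h]
      · simp [Finsupp.erase_ne hi]
  right_inv c := Subtype.ext (Finsupp.single_add_erase a c.1)

/-- Each new index multiplies the sum by an absolutely convergent geometric series. -/
theorem hasSum_finsuppProd_support_subset {𝕜 : Type*} [NormedField 𝕜] [CompleteSpace 𝕜] {z : ι → 𝕜} (hz : ∀ i, ‖z i‖ < 1)
    (s : Finset ι) :
    Summable (fun c : {c : ι →₀ ℕ // c.support ⊆ s} => ‖c.1.prod fun i n => z i ^ n‖) ∧
    HasSum (fun c : {c : ι →₀ ℕ // c.support ⊆ s} => c.1.prod fun i n => z i ^ n)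
      (∏ i ∈ s, (1 - z i)⁻¹) := by
  classical
  induction s using Finset.induction_on with
  | empty =>
    have : Unique {c : ι →₀ ℕ // c.support ⊆ ∅} :=
      { default := ⟨0, by simp⟩
        uniq := fun c => Subtype.ext (by simpa using c.2) }
    refine ⟨Summable.of_finite, ?_⟩
    convert hasSum_unique _
    · rw [show (default : {c : ι →₀ ℕ // c.support ⊆ ∅}) = ⟨0, by simp⟩ from Subsingleton.elim _ _]
      simp
  | insert a s ha ih =>
    have hprod (x : ℕ × {c : ι →₀ ℕ // c.support ⊆ s}) :
        ((Finsupp.supportInsertEquiv ha x).1.prod fun i n => z i ^ n) =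
        z a ^ x.1 * x.2.1.prod fun i n => z i ^ n := by
      change (Finsupp.single a x.1 + x.2.1).prod _ = _
      rw [Finsupp.prod_add_index' (by simp) (fun i m n => pow_add _ _ _),
        Finsupp.prod_single_index (by simp)]
    have hgeo : Summable fun n : ℕ => ‖z a ^ n‖ := summable_norm_geometric_of_norm_lt_one (hz a)
    rw [← (Finsupp.supportInsertEquiv ha).summable_iff, ← (Finsupp.supportInsertEquiv ha).hasSum_iff,
      Finset.prod_insert ha]
    simp only [Function.comp_def, hprod]
    let g : {c : ι →₀ ℕ // c.support ⊆ s} → 𝕜 := fun c => c.1.prod fun i n => z i ^ n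
    exact ⟨Summable.mul_norm (f := fun n : ℕ => z a ^ n) (g := g) hgeo ih.1,
      HasSum.mul (f := fun n : ℕ => z a ^ n) (g := g) (hasSum_geometric_of_norm_lt_one (hz a)) ih.2
        (summable_mul_of_summable_norm (f := fun n : ℕ => z a ^ n) (g := g) hgeo ih.1)⟩

/-- The term has norm |z|/|1 - z| ≤ 2|z| once |z| < 1/2, which holds for all but finitely many
indices. -/
theorem summable_norm_one_sub_inv_sub_one {𝕜 : Type*} [NormedField 𝕜] [CompleteSpace 𝕜] {z : ι → 𝕜}
    (hs : Summable fun i => ‖z i‖) : Summable fun i => ‖(1 - z i)⁻¹ - 1‖ := by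
  refine Summable.of_norm_bounded_eventually (g := fun i => 2 * ‖z i‖) (hs.mul_left 2) ?_
  have h := hs.tendsto_cofinite_zero.eventually (gt_mem_nhds (show (0 : ℝ) < 1 / 2 by norm_num))
  filter_upwards [h] with i hi
  have h1 : 1 / 2 ≤ ‖1 - z i‖ := by
    have := norm_sub_norm_le (1 : 𝕜) (z i)
    rw [norm_one] at this
    linarith
  have h2 : 1 - z i ≠ 0 := norm_pos_iff.mp (by linarith)
  have h3 : (1 - z i)⁻¹ - 1 = z i / (1 - z i) := by field_simp; ring
  rw [norm_norm, h3, norm_div, div_le_iff₀ (by linarith)]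
  nlinarith [norm_nonneg (z i)]

theorem hasProd_one_sub_inv {𝕜 : Type*} [NormedField 𝕜] [CompleteSpace 𝕜] {z : ι → 𝕜}
    (hs : Summable fun i => ‖z i‖) :
    HasProd (fun i => (1 - z i)⁻¹) (∏' i, (1 - z i)⁻¹) := by
  have := multipliable_one_add_of_summable (f := fun i => (1 - z i)⁻¹ - 1) (summable_norm_one_sub_inv_sub_one hs)
  simpa using this.hasProd

/-- A finite set of exponents has its supports in one finite set s, so its sum is at most a partial
product of the factors (1 - |z i|)⁻¹ ≥ 1, hence at most the full product. -/
theorem summable_norm_finsuppProd {𝕜 : Type*} [NormedField 𝕜] [CompleteSpace 𝕜] {z : ι → 𝕜} (hz : ∀ i, ‖z i‖ < 1)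
    (hs : Summable fun i => ‖z i‖) :
    Summable fun c : ι →₀ ℕ => ‖c.prod fun i n => z i ^ n‖ := by
  classical
  have hnorm (c : ι →₀ ℕ) : ‖c.prod fun i n => z i ^ n‖ = c.prod fun i n => ‖z i‖ ^ n := by
    simp [Finsupp.prod, norm_prod]
  have hz' : ∀ i, ‖‖z i‖‖ < 1 := by simpa using hz
  have hp := hasProd_one_sub_inv (z := fun i => ‖z i‖) (by simpa using hs)
  have hmono : Monotone fun s : Finset ι => ∏ i ∈ s, (1 - ‖z i‖)⁻¹ := fun s t hst =>
    Finset.prod_le_prod_of_subset_of_one_le hst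
      (fun i _ => inv_nonneg.mpr (sub_nonneg.mpr (hz i).le)) fun i _ _ =>
      (one_le_inv₀ (sub_pos.mpr (hz i))).mpr (sub_le_self _ (norm_nonneg _))
  refine summable_of_sum_le (c := ∏' i, (1 - ‖z i‖)⁻¹) (fun _ => norm_nonneg _) fun u => ?_
  let s := u.biUnion Finsupp.support
  obtain ⟨h1, h2⟩ := hasSum_finsuppProd_support_subset hz' s
  refine le_trans ?_ (hmono.ge_of_tendsto hp s)
  have h3 : ∀ c ∈ u, c.support ⊆ s := fun c hc => Finset.subset_biUnion_of_mem _ hc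
  calc ∑ c ∈ u, ‖c.prod fun i n => z i ^ n‖
      = ∑ c ∈ u.attach, c.1.prod fun i n => ‖z i‖ ^ n := by
        rw [Finset.sum_attach u fun c => c.prod fun i n => ‖z i‖ ^ n]
        exact Finset.sum_congr rfl fun c _ => hnorm c
    _ = ∑ c ∈ u.attach.map ⟨fun c => (⟨c.1, h3 c.1 c.2⟩ : {c : ι →₀ ℕ // c.support ⊆ s}),
          fun a b h => Subtype.ext (congrArg (fun x => x.1) h)⟩, c.1.prod fun i n => ‖z i‖ ^ n := by
        rw [Finset.sum_map]
        rfl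
    _ ≤ _ := sum_le_hasSum _ (fun c _ => Finset.prod_nonneg fun i _ => by positivity) h2

/-- Dominated convergence as s grows: the sums over exponents supported in s are the finite partial
products. -/
theorem hasSum_finsuppProd {z : ι → ℂ} (hz : ∀ i, ‖z i‖ < 1)
    (hs : Summable fun i => ‖z i‖) :
    HasSum (fun c : ι →₀ ℕ => c.prod fun i n => z i ^ n) (∏' i, (1 - z i)⁻¹) := by
  classical
  have hsum := summable_norm_finsuppProd hz hs
  have h := tendsto_tsum_of_dominated_convergence (𝓕 := Filter.atTop)
    (f := fun (s : Finset ι) (c : ι →₀ ℕ) =>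
      Set.indicator {c : ι →₀ ℕ | c.support ⊆ s} (fun c => c.prod fun i n => z i ^ n) c)
    (g := fun c => c.prod fun i n => z i ^ n) hsum (fun c => ?_) ?_
  · have h' := h.congr fun s => (tsum_subtype {c : ι →₀ ℕ | c.support ⊆ s}
      fun c => c.prod fun i n => z i ^ n).symm.trans
      (hasSum_finsuppProd_support_subset hz s).2.tsum_eq
    rw [tendsto_nhds_unique (hasProd_one_sub_inv hs) h']
    exact hsum.of_norm.hasSum
  · refine tendsto_const_nhds.congr' ?_
    filter_upwards [Filter.eventually_ge_atTop c.support] with s hs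
    rw [Set.indicator_of_mem]
    exact hs
  · exact Filter.Eventually.of_forall fun s c => norm_indicator_le_norm_self _ _

end EulerProduct

/-! ### Series indexed by norms. -/

section NormSeries

variable {ι : Type*} {N : ι → ℕ}

theorem Finsupp.finite_setOf_prod_pow_eq (hN : ∀ i, 2 ≤ N i) (hfin : ∀ q, Finite {i // N i = q})
    (n : ℕ) : Finite {c : ι →₀ ℕ // (c.prod fun i k => N i ^ k) = n} := by
  classical
  rcases Nat.eq_zero_or_pos n with rfl | hn
  · have : IsEmpty {c : ι →₀ ℕ // (c.prod fun i k => N i ^ k) = 0} := ⟨fun c => by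
      have := c.2
      simp only [Finsupp.prod, Finset.prod_eq_zero_iff] at this
      obtain ⟨i, -, hi⟩ := this
      exact absurd hi (pow_ne_zero _ (by have := hN i; omega))⟩
    infer_instance
  have hS : {i | N i ≤ n}.Finite := by
    have : {i | N i ≤ n} = ⋃ q ∈ Set.Iic n, {i | N i = q} := by ext; simp
    rw [this]
    exact (Set.finite_Iic n).biUnion fun q _ => Set.finite_coe_iff.mp (hfin q)
  -- Norm n forces N i ≤ n on the support, and c i < N i ^ c i ≤ n since N i ≥ 2; hence c ≤ g.
  let g : ι →₀ ℕ := Finsupp.indicator hS.toFinset fun _ _ => n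
  refine ((Set.finite_Iic g).subset fun c hc => ?_).to_subtype
  intro i
  by_cases hi : i ∈ c.support
  · have h1 : N i ^ c i ∣ n := by
      rw [← show _ = n from hc]
      exact Finset.dvd_prod_of_mem (fun i => N i ^ c i) hi
    have h2 : N i ^ c i ≤ n := Nat.le_of_dvd hn h1
    have h3 : N i ≤ n := le_trans (Nat.le_self_pow (Finsupp.mem_support_iff.mp hi) _) h2
    have h4 : c i ≤ n := ((Nat.lt_pow_self (hN i)).trans_le h2).le
    simpa [g, Finsupp.indicator_apply, h3] using h4
  · rw [Finsupp.notMem_support_iff.mp hi]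
    exact Nat.zero_le _

theorem Complex.natCast_cpow_finsuppProd (c : ι →₀ ℕ) (s : ℂ) :
    ((c.prod fun i k => N i ^ k : ℕ) : ℂ) ^ s = c.prod fun i k => ((N i : ℂ) ^ s) ^ k := by
  let φ : ℕ →* ℂ :=
    { toFun := fun n => (n : ℂ) ^ s
      map_one' := by simp
      map_mul' := fun m n => by rw [Nat.cast_mul, Complex.natCast_mul_natCast_cpow] }
  change φ _ = _
  rw [map_finsuppProd]
  exact Finsupp.prod_congr fun i _ => map_pow φ _ _

theorem summable_norm_natCast_cpow_neg (hN : ∀ i, 2 ≤ N i) {s : ℂ}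
    (hs : ∑' i, (N i : ℝ≥0∞) ^ (-s.re) ≠ ⊤) : Summable fun i => ‖(N i : ℂ) ^ (-s)‖ := by
  refine (ENNReal.summable_toReal hs).congr fun i => ?_
  rw [Complex.norm_natCast_cpow_of_pos (by have := hN i; omega), ← ENNReal.toReal_rpow]
  simp

theorem norm_natCast_cpow_neg_lt_one (hN : ∀ i, 2 ≤ N i) {s : ℂ} (hs : 0 < s.re) (i : ι) :
    ‖(N i : ℂ) ^ (-s)‖ < 1 := by
  have := hN i
  rw [Complex.norm_natCast_cpow_of_pos (by omega)]
  exact Real.rpow_lt_one_of_one_lt_of_neg (by exact_mod_cast this) (by simpa using hs)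

/-- Grouping a series by a map to `ℕ` with finite fibres. -/
theorem hasSum_card_fiber_mul {γ : Type*} {M : γ → ℕ} (hM : ∀ n, Finite {c // M c = n})
    {R : Type*} [NormedField R] {f : ℕ → R} {a : R} (h : HasSum (fun c => f (M c)) a) :
    HasSum (fun n => (Nat.card {c // M c = n} : R) * f n) a := by
  rw [← (Equiv.sigmaFiberEquiv M).hasSum_iff] at h
  refine h.sigma fun n => ?_
  have := Fintype.ofFinite {c // M c = n}
  have h1 : ∀ c : {c // M c = n}, ((fun c => f (M c)) ∘ Equiv.sigmaFiberEquiv M) ⟨n, c⟩ = f n :=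
    fun c => congrArg f c.2
  simp_rw [h1]
  simpa using hasSum_fintype fun _ : {c // M c = n} => f n

theorem LSeriesHasSum_card_fiber {γ : Type*} {M : γ → ℕ} (hM0 : ∀ c, M c ≠ 0)
    (hM : ∀ n, Finite {c // M c = n}) {s a : ℂ}
    (hs : Summable fun c => ‖(M c : ℂ) ^ (-s)‖) (h : HasSum (fun c => (M c : ℂ) ^ (-s)) a) :
    Summable (fun n => ‖LSeries.term (fun n => (Nat.card {c // M c = n} : ℂ)) s n‖) ∧
      LSeriesHasSum (fun n => (Nat.card {c // M c = n} : ℂ)) s a := by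
  have hterm (n : ℕ) : LSeries.term (fun n => (Nat.card {c // M c = n} : ℂ)) s n =
      (Nat.card {c // M c = n} : ℂ) * (n : ℂ) ^ (-s) := by
    -- `LSeries.term` is 0 at n = 0 by convention; the fibre over 0 is empty, so both sides agree.
    rcases eq_or_ne n 0 with rfl | hn
    · have : IsEmpty {c // M c = 0} := ⟨fun c => hM0 _ c.2⟩
      simp
    · rw [LSeries.term_of_ne_zero hn, Complex.cpow_neg, div_eq_mul_inv]
  constructor
  · refine (hasSum_card_fiber_mul hM (f := fun n => ‖(n : ℂ) ^ (-s)‖) hs.hasSum).summable.congr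
      fun n => ?_
    rw [hterm, norm_mul, Complex.norm_natCast]
  · unfold LSeriesHasSum
    rw [funext hterm]
    exact hasSum_card_fiber_mul hM (f := fun n => (n : ℂ) ^ (-s)) h

end NormSeries

/-- For finiteness alone, any presentation as a quotient of ℤ[X₁,…,Xₙ] suffices, with no control of
n. -/
theorem MaximalSpectrum.finite_card_quotient_eq {A : Type u} [CommRing A] [Algebra.FiniteType ℤ A]
    (q : ℕ) : Finite {m : MaximalSpectrum A // Nat.card (A ⧸ m.asIdeal) = q} := by
  obtain ⟨n, f, hf⟩ := Algebra.FiniteType.iff_quotient_mvPolynomial''.mp ‹Algebra.FiniteType ℤ A›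
  let := f.toRingHom.toAlgebra
  have : Module.Finite (MvPolynomial (Fin n) ℤ) A :=
    .of_surjective (Algebra.linearMap (MvPolynomial (Fin n) ℤ) A) hf
  obtain ⟨C, hC⟩ := exists_card_ringHom_le_mul_pow (d := n) (S := ℤ) (A := A)
    fun F _ => inferInstance
  have hcard := card_maximalSpectrum_le_card_ringHom (RingHom.id A) Set.univ
    (fun m _ => Ideal.Quotient.finite_of_isMaximal_of_finiteType_int m.asIdeal)
    (fun m _ => ⟨Ideal.Quotient.mk _, RingHom.comp_id _⟩) hC q
  have : Finite {m : (Set.univ : Set (MaximalSpectrum A)) // Nat.card (A ⧸ m.1.asIdeal) = q} :=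
    ENat.card_lt_top.mp (hcard.trans_lt (ENat.natCast_lt_top _))
  exact Finite.of_injective (β := {m : (Set.univ : Set (MaximalSpectrum A)) // Nat.card (A ⧸ m.1.asIdeal) = q})
    (fun m => ⟨⟨m.1, trivial⟩, m.2⟩) fun a b h => Subtype.ext (congrArg (fun x => x.1.1) h)

/-! ### Affine charts and closed points. -/

namespace AlgebraicGeometry.Scheme

variable {X : Scheme.{u}}

theorem IsFiniteTypeInt.finiteType_int (hX : X.IsFiniteTypeInt) {R : CommRingCat.{u}}
    (f : Spec R ⟶ X) [IsOpenImmersion f] : Algebra.FiniteType ℤ R := by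
  have := hX.locallyOfFiniteType
  have h1 : LocallyOfFiniteType (f ≫ specULiftZIsTerminal.from X) := inferInstance
  obtain ⟨φ, hφ⟩ := Spec.map_surjective (f ≫ specULiftZIsTerminal.from X)
  rw [← hφ, HasRingHomProperty.Spec_iff (P := @LocallyOfFiniteType)] at h1
  have h2 : (ULift.ringEquiv.symm : ℤ ≃+* ULift.{u} ℤ).toRingHom.FiniteType :=
    RingHom.FiniteType.of_surjective _ (ULift.ringEquiv.symm : ℤ ≃+* ULift.{u} ℤ).surjective
  have h3 := h1.comp h2
  rw [RingHom.ext_int (φ.hom.comp _) (algebraMap ℤ R)] at h3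
  exact RingHom.finiteType_algebraMap.mp h3

theorem IsFiniteTypeInt.compactSpace (hX : X.IsFiniteTypeInt) : CompactSpace X := by
  have := hX.quasiCompact
  exact (quasiCompact_iff_compactSpace (specULiftZIsTerminal.from X)).mp this

theorem exists_residueField_equiv {R : CommRingCat.{u}} (f : Spec R ⟶ X) [IsOpenImmersion f]
    (y : Spec R) [y.asIdeal.IsMaximal] :
    Nonempty ((R ⧸ y.asIdeal) ≃ X.residueField (f y)) :=
  ⟨((RingEquiv.ofBijective _ (Ideal.bijective_algebraMap_quotient_residueField y.asIdeal)).toEquiv.trans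
    (Spec.residueFieldIso R y).symm.commRingCatIsoToRingEquiv.toEquiv).trans
    (asIso (f.residueFieldMap y)).symm.commRingCatIsoToRingEquiv.toEquiv⟩

theorem ringKrullDim_le_topologicalKrullDim {R : CommRingCat.{u}} (f : Spec R ⟶ X)
    [IsOpenImmersion f] : ringKrullDim R ≤ topologicalKrullDim X := by
  rw [← PrimeSpectrum.topologicalKrullDim_eq_ringKrullDim]
  exact f.isOpenEmbedding.isInducing.topologicalKrullDim_le

theorem isMaximal_of_mem_closedPoints {R : CommRingCat.{u}} (f : Spec R ⟶ X) [IsOpenImmersion f]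
    {y : Spec R} (hy : f y ∈ closedPoints X) : y.asIdeal.IsMaximal :=
  (PrimeSpectrum.isClosed_singleton_iff_isMaximal y).mp
    (preimage_closedPoints_subset f.isOpenEmbedding.injective f.continuous hy)

end AlgebraicGeometry.Scheme

namespace SchemeZeta

open Scheme

variable {X : Scheme.{u}}

/-- Closed points in an affine chart inject into the maximal spectrum, with the same residue
fields. -/
theorem exists_injective_maximalSpectrum {R : CommRingCat.{u}} (f : Spec R ⟶ X)
    [IsOpenImmersion f] : ∃ φ : {x : ClosedPoint X | x.1 ∈ Set.range f} → MaximalSpectrum R,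
      Function.Injective φ ∧ ∀ x, Nonempty ((R ⧸ (φ x).asIdeal) ≃ X.residueField x.1.1) := by
  choose y hy using fun x : {x : ClosedPoint X | x.1 ∈ Set.range f} => x.2
  have hmax (x) : (y x).asIdeal.IsMaximal :=
    isMaximal_of_mem_closedPoints f (by rw [hy]; exact x.1.2)
  refine ⟨fun x => ⟨(y x).asIdeal, hmax x⟩, fun a b h => ?_, fun x => ?_⟩
  · have : y a = y b := PrimeSpectrum.ext (congrArg MaximalSpectrum.asIdeal h)
    exact Subtype.ext (Subtype.ext (by rw [← hy a, ← hy b, this]))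
  · have := hmax x
    rw [← hy x]
    exact exists_residueField_equiv f (y x)

/-- A finite cover of a scheme of finite type over `ℤ` by spectra. -/
theorem exists_finite_cover (hX : X.IsFiniteTypeInt) : ∃ (J : Type u) (_ : Finite J)
    (R : J → CommRingCat.{u}) (f : ∀ j, Spec (R j) ⟶ X), (∀ j, IsOpenImmersion (f j)) ∧
      ∀ x : X, ∃ j, x ∈ Set.range (f j) := by
  have := hX.compactSpace
  let 𝒰 := X.affineCover.finiteSubcover
  refine ⟨𝒰.I₀, inferInstance, fun j => _, fun j => 𝒰.f j, fun j => inferInstanceAs (IsOpenImmersion (𝒰.f j)), fun x => ?_⟩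
  exact 𝒰.exists_eq x

theorem finite_residueField (hX : X.IsFiniteTypeInt) (x : ClosedPoint X) :
    Finite (X.residueField x.1) := by
  obtain ⟨J, _, R, f, _, hf⟩ := exists_finite_cover hX
  obtain ⟨j, hj⟩ := hf x.1
  obtain ⟨φ, -, hφ⟩ := exists_injective_maximalSpectrum (f j)
  obtain ⟨e⟩ := hφ ⟨x, hj⟩
  have := hX.finiteType_int (f j)
  have := Ideal.Quotient.finite_of_isMaximal_of_finiteType_int (φ ⟨x, hj⟩).asIdeal
  exact Finite.of_equiv _ e

theorem two_le_pointNorm (hX : X.IsFiniteTypeInt) (x : ClosedPoint X) : 2 ≤ pointNorm x :=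
  have := finite_residueField hX x
  Finite.one_lt_card

theorem finite_pointNorm_eq (hX : X.IsFiniteTypeInt) (q : ℕ) :
    Finite {x : ClosedPoint X // pointNorm x = q} := by
  obtain ⟨J, _, R, f, _, hf⟩ := exists_finite_cover hX
  have h : {x : ClosedPoint X | pointNorm x = q} =
      ⋃ j, {x : ClosedPoint X | x.1 ∈ Set.range (f j) ∧ pointNorm x = q} := by
    ext x
    have := hf x.1
    simp only [Set.mem_iUnion, Set.mem_ofPred_eq]
    tauto
  change Finite ({x : ClosedPoint X | pointNorm x = q} : Set _)
  rw [h]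
  refine (Set.finite_iUnion fun j => ?_).to_subtype
  obtain ⟨φ, hφinj, hφ⟩ := exists_injective_maximalSpectrum (f j)
  have := hX.finiteType_int (f j)
  have := MaximalSpectrum.finite_card_quotient_eq (A := R j) q
  have hcard (x : {x : ClosedPoint X | x.1 ∈ Set.range (f j) ∧ pointNorm x = q}) :
      Nat.card (R j ⧸ (φ ⟨x.1, x.2.1⟩).asIdeal) = q := by
    obtain ⟨e⟩ := hφ ⟨x.1, x.2.1⟩
    rw [Nat.card_congr e]
    exact x.2.2
  exact Set.finite_coe_iff.mp (Finite.of_injective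
    (β := {m : MaximalSpectrum (R j) // Nat.card (R j ⧸ m.asIdeal) = q})
    (fun x => ⟨φ ⟨x.1, x.2.1⟩, hcard x⟩)
    fun a b h => Subtype.ext (congrArg (fun x => x.1) (hφinj (congrArg Subtype.val h))))

/-- Positivity of σ is conditional because the empty scheme has dimension -∞ and allows every σ. -/
theorem tsum_pointNorm_ne_top (hX : X.IsFiniteTypeInt) {σ : ℝ} (hσ : X.dimEReal < (σ : EReal)) :
    ∑' x : ClosedPoint X, (pointNorm x : ℝ≥0∞) ^ (-σ) ≠ ⊤ ∧ (Nonempty X → 0 < σ) := by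
  rcases isEmpty_or_nonempty X with h | ⟨⟨x₀⟩⟩
  · have : IsEmpty (ClosedPoint X) := ⟨fun x => h.elim x.1⟩
    exact ⟨by simp, fun h' => (not_nonempty_iff.mpr h h').elim⟩
  obtain ⟨d, hd, hdσ⟩ : ∃ d : ℕ, topologicalKrullDim X = d ∧ d < σ := by
    unfold dimEReal at hσ
    have hbot : topologicalKrullDim X ≠ ⊥ := by
      have : Nonempty (TopologicalSpace.IrreducibleCloseds X) :=
        ⟨⟨closure {x₀}, isIrreducible_singleton.closure, isClosed_closure⟩⟩
      exact (lt_of_lt_of_le (WithBot.bot_lt_coe 0) Order.krullDim_nonneg).ne'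
    induction h : topologicalKrullDim X using WithBot.recBotCoe with
    -- Nonemptiness excludes -∞ and the bound by the real number σ excludes +∞, so the dimension is
    -- a natural number.
    | bot => exact absurd h hbot
    | coe n =>
      rw [h] at hσ
      induction n using ENat.recTopCoe with
      | top =>
        change (((⊤ : ℕ∞) : ℝ≥0∞) : EReal) < σ at hσ
        simp at hσ
      | coe d =>
        change (((d : ℕ∞) : ℝ≥0∞) : EReal) < σ at hσ
        refine ⟨d, rfl, EReal.coe_lt_coe_iff.mp ?_⟩
        rwa [ENat.toENNReal_coe, ← ENNReal.ofReal_natCast, EReal.coe_ennreal_ofReal,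
          max_eq_left (Nat.cast_nonneg d)] at hσ
  refine ⟨?_, fun _ => lt_of_le_of_lt (Nat.cast_nonneg d) hdσ⟩
  obtain ⟨J, _, R, f, _, hf⟩ := exists_finite_cover hX
  refine ENNReal.tsum_ne_top_of_cover (fun j => {x : ClosedPoint X | x.1 ∈ Set.range (f j)})
    (fun x => hf x.1) _ fun j => ?_
  obtain ⟨φ, hφinj, hφ⟩ := exists_injective_maximalSpectrum (f j)
  have := hX.finiteType_int (f j)
  refine ne_top_of_le_ne_top (maximalIdealSum_ne_top (A := R j)
    ((ringKrullDim_le_topologicalKrullDim (f j)).trans hd.le) hdσ) ?_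
  refine le_trans (le_of_eq (tsum_congr fun x => ?_)) (ENNReal.tsum_comp_le_tsum_of_injective hφinj _)
  obtain ⟨e⟩ := hφ x
  rw [Nat.card_congr e]
  rfl

end SchemeZeta

/-! ### Assembly. -/

theorem mainTheorem9 (X : Scheme.{u}) (hX : X.IsFiniteTypeInt) :
    -- the terms of the product and of the series are well defined
    (∀ x : SchemeZeta.ClosedPoint X, Finite (X.residueField x.1)) ∧
    (∀ n : ℕ, Finite {c : SchemeZeta.EffectiveZeroCycle X // SchemeZeta.cycleNorm c = n}) ∧
    ∀ s : ℂ, X.dimEReal < (s.re : EReal) →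
      -- absolute convergence as an infinite product
      (∀ x : SchemeZeta.ClosedPoint X, 1 - (SchemeZeta.pointNorm x : ℂ) ^ (-s) ≠ 0) ∧
      Summable (fun x : SchemeZeta.ClosedPoint X => ‖SchemeZeta.eulerFactor X s x - 1‖) ∧
      HasProd (fun x : SchemeZeta.ClosedPoint X => SchemeZeta.eulerFactor X s x)
        (SchemeZeta.zeta X s) ∧
      -- absolute convergence as a series over effective zero-cycles
      Summable (fun c : SchemeZeta.EffectiveZeroCycle X =>
        ‖(SchemeZeta.cycleNorm c : ℂ) ^ (-s)‖) ∧
      HasSum (fun c : SchemeZeta.EffectiveZeroCycle X => (SchemeZeta.cycleNorm c : ℂ) ^ (-s))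
        (SchemeZeta.zeta X s) ∧
      -- absolute convergence as a Dirichlet series
      Summable (fun n : ℕ => ‖LSeries.term (SchemeZeta.dirichletCoeff X) s n‖) ∧
      LSeriesHasSum (SchemeZeta.dirichletCoeff X) s (SchemeZeta.zeta X s) := by
  have hN := SchemeZeta.two_le_pointNorm hX
  have hfin := Finsupp.finite_setOf_prod_pow_eq hN (SchemeZeta.finite_pointNorm_eq hX)
  refine ⟨SchemeZeta.finite_residueField hX, hfin, fun s hs => ?_⟩
  obtain ⟨htop, hpos⟩ := SchemeZeta.tsum_pointNorm_ne_top hX hs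
  have hz (x : SchemeZeta.ClosedPoint X) : ‖(SchemeZeta.pointNorm x : ℂ) ^ (-s)‖ < 1 :=
    norm_natCast_cpow_neg_lt_one hN (hpos ⟨x.1⟩) x
  have hsum := summable_norm_natCast_cpow_neg hN htop
  have hcyc (c : SchemeZeta.EffectiveZeroCycle X) : (SchemeZeta.cycleNorm c : ℂ) ^ (-s) =
      c.prod fun x n => ((SchemeZeta.pointNorm x : ℂ) ^ (-s)) ^ n :=
    Complex.natCast_cpow_finsuppProd c (-s)
  have h1 : Summable (fun c : SchemeZeta.EffectiveZeroCycle X =>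
      ‖(SchemeZeta.cycleNorm c : ℂ) ^ (-s)‖) := by
    simp_rw [hcyc]
    exact summable_norm_finsuppProd hz hsum
  have h2 : HasSum (fun c : SchemeZeta.EffectiveZeroCycle X =>
      (SchemeZeta.cycleNorm c : ℂ) ^ (-s)) (SchemeZeta.zeta X s) := by
    simp_rw [hcyc]
    exact hasSum_finsuppProd hz hsum
  have hne (c : SchemeZeta.EffectiveZeroCycle X) : SchemeZeta.cycleNorm c ≠ 0 :=
    Finset.prod_ne_zero_iff.mpr fun x _ => pow_ne_zero _ (by have := hN x; omega)
  refine ⟨fun x h => ?_, summable_norm_one_sub_inv_sub_one hsum, hasProd_one_sub_inv hsum, h1, h2,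
    LSeriesHasSum_card_fiber hne hfin h1 h2⟩
  have := hz x
  rw [← sub_eq_zero.mp h, norm_one] at this
  exact lt_irrefl _ this
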